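/- There is a universal constant $C>0$ such that the following holds. Let $2\le s\le n$ and let $M,m$ be non-negative integers. Let $A_0\in\mathbb C^{n\times n}$ be unitary, with rows $a_1^*,\dots,a_n^*$, let $(I_k)_{1\le k\le M}$ be a partition of $\{1,\dots,n\}$, and let $B_k=(a_i^*)_{i\in I_k}$ be the corresponding blocks of rows. Let $\pi=(\pi_k)_{1\le k\le M}$ be a probability distribution with $\pi_k>0$ for all $k$. For $S\subset\{1,\dots,n\}$ let $P_S$ be the diagonal projection onto the coordinates in $S$, $B_{k,S}=B_kP_S$, and $$\Theta(S,\pi)=\max_{1\le k\le M}\frac{1}{\pi_k}\|B_k^*B_{k,S}\|_{\infty\to\infty},\qquad \Upsilon(S,\pi)=\max_{1\le i\le n}\ \sup_{v\in\mathbb C^n,\ \|v\|_\infty\le1}\ \sum_{k=1}^M\frac1{\pi_k}\left|e_i^*B_k^*B_{k,S}v\right|^2,$$ $$\Gamma(S,\pi)=\max\left(\Upsilon(S,\pi),\Theta(S,\pi)\right).$$ Let $S$ be a random subset of $\{1,\dots,n\}$ with $|S|\le s$ almost surely, let $x$ be a random vector in $\mathbb C^n$ that is almost surely supported on $S$ (a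 deterministic function of $S$, for instance), let $K_1,\dots,K_m$ be i.i.d. with $\mathbb P(K_\ell=k)=\pi_k$, independent of the pair $(S,x)$, and let $$A=\frac1{\sqrt m}\left(\frac1{\sqrt{\pi_{K_\ell}}}B_{K_\ell}\right)_{1\le\ell\le m}.$$ Let $\gamma>0$, $\varepsilon\in(0,1)$ and $\varepsilon'(\gamma)\in\mathbb R$ be such that $\mathbb P\left(\Gamma(S,\pi)\le\gamma\right)\ge1-\varepsilon'(\gamma)$. If $$m\ge C\,\gamma\,\ln(s)\,\ln(n/\varepsilon),$$ then, with probability at least $(1-\varepsilon)(1-\varepsilon'(\gamma))=1-\varepsilon-\varepsilon'(\gamma)+\varepsilon\varepsilon'(\gamma)$, the vector $x$ is the unique solution of $\min\{\|z\|_1: z\in\mathbb C^n,\ Az=Ax\}$. -/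

import Mathlib

open MeasureTheory ProbabilityTheory
open scoped Matrix

noncomputable section

namespace BlockCS

/-- The `ℓ¹` norm of a complex vector. -/
def l1Norm {n : ℕ} (z : Fin n → ℂ) : ℝ := ∑ i, ‖z i‖

/-- The diagonal projection matrix `P_S` onto the coordinates in `S`. -/
def projS {n : ℕ} (S : Set (Fin n)) : Matrix (Fin n) (Fin n) ℂ :=
  open Classical in Matrix.diagonal fun i => if i ∈ S then 1 else 0

/-- The operator norm `‖M‖_{∞ → ∞} = sup_{‖v‖_∞ ≤ 1} ‖M v‖_∞` (the norm on `Fin n → ℂ` is the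
sup norm). -/
def opNormInf {n : ℕ} (M : Matrix (Fin n) (Fin n) ℂ) : ℝ :=
  ⨆ v : {v : Fin n → ℂ // ‖v‖ ≤ 1}, ‖M *ᵥ v.1‖

/-- The block `B_k` made of the rows of `A₀` indexed by `I k`. -/
def block {n M : ℕ} (A₀ : Matrix (Fin n) (Fin n) ℂ) (I : Fin M → Finset (Fin n)) (k : Fin M) :
    Matrix (I k) (Fin n) ℂ :=
  Matrix.of fun i j => A₀ i.1 j

/-- The matrix `B_k^* B_{k,S}`, where `B_{k,S} = B_k P_S`. -/
def blockGram {n M : ℕ} (A₀ : Matrix (Fin n) (Fin n) ℂ) (I : Fin M → Finset (Fin n))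
    (S : Set (Fin n)) (k : Fin M) : Matrix (Fin n) (Fin n) ℂ :=
  (block A₀ I k)ᴴ * (block A₀ I k * projS S)

/-- `Θ(S, π) = max_k ‖B_k^* B_{k,S}‖_{∞ → ∞} / π_k`. -/
def Theta {n M : ℕ} (A₀ : Matrix (Fin n) (Fin n) ℂ) (I : Fin M → Finset (Fin n))
    (π : Fin M → ℝ) (S : Set (Fin n)) : ℝ :=
  ⨆ k : Fin M, 1 / π k * opNormInf (blockGram A₀ I S k)

/-- `Υ(S, π) = max_i sup_{‖v‖_∞ ≤ 1} ∑_k |e_i^* B_k^* B_{k,S} v|² / π_k`. -/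
def Upsilon {n M : ℕ} (A₀ : Matrix (Fin n) (Fin n) ℂ) (I : Fin M → Finset (Fin n))
    (π : Fin M → ℝ) (S : Set (Fin n)) : ℝ :=
  ⨆ i : Fin n, ⨆ v : {v : Fin n → ℂ // ‖v‖ ≤ 1},
    ∑ k, 1 / π k * ‖(blockGram A₀ I S k *ᵥ v.1) i‖ ^ 2

/-- `Γ(S, π) = max (Υ(S, π)) (Θ(S, π))`. -/
def Gam {n M : ℕ} (A₀ : Matrix (Fin n) (Fin n) ℂ) (I : Fin M → Finset (Fin n))
    (π : Fin M → ℝ) (S : Set (Fin n)) : ℝ :=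
  max (Upsilon A₀ I π S) (Theta A₀ I π S)

/-- The sensing matrix obtained by stacking the `m` blocks `B_{K_ℓ} / √(m π_{K_ℓ})`, for a list
`K` of `m` block indices. Its rows are the pairs `(ℓ, i)` with `i ∈ I (K ℓ)`. -/
def sensing {n M m : ℕ} (A₀ : Matrix (Fin n) (Fin n) ℂ) (I : Fin M → Finset (Fin n))
    (π : Fin M → ℝ) (K : Fin m → Fin M) : Matrix (Σ ℓ : Fin m, I (K ℓ)) (Fin n) ℂ :=
  Matrix.of fun r j =>
    ((1 / √(m : ℝ) * (1 / √(π (K r.1))) : ℝ) : ℂ) * block A₀ I (K r.1) r.2 j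

/-- `x` is the unique solution of the problem: minimise `‖z‖₁` over `z ∈ ℂⁿ` with `A z = y`. -/
def IsUniqueL1Min {ι : Type*} {n : ℕ} (A : Matrix ι (Fin n) ℂ) (y : ι → ℂ)
    (x : Fin n → ℂ) : Prop :=
  A *ᵥ x = y ∧ ∀ z : Fin n → ℂ, A *ᵥ z = y → z ≠ x → l1Norm x < l1Norm z

end BlockCS

end

/-! Recovery follows from the golfing scheme, run forwards on fixed vectors. The samples are cut
into `L` rounds of `q`. In a round, let `H` be the empirical mean of `B_k^* B_{k,S} / π_k`;
unitarity makes its expectation act as the identity on vectors supported on `S`. For such a fixed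
`v`, `Θ` bounds each entry and `Υ` its second moment, so Bernstein and a union bound over
coordinates give `‖v - H v‖_∞ ≤ ‖v‖_∞ / 4` with high probability (`wt_resid_le`). The next state is
the restriction of `v - H v` to `S`; it depends only on past rounds, so fresh samples treat it as
fixed.

If `A h = 0`, every sampled block kills `h`, so `⟨v, h⟩ = ⟨v - H v, h⟩`. Off `S` this costs at most
`‖v‖_∞ ‖h_{Sᶜ}‖₁ / 4`; on `S` one iterates. The outcome is `|⟨v, h⟩| ≤ ‖v‖_∞ (4^{-L} ‖h_S‖₁ +
‖h_{Sᶜ}‖₁ / 3)` (`GolfGood.norm_dotProduct_le`).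

No local isometry estimate in `ℓ²` is needed. Applying this to every `e_i`, `i ∈ S`, and summing
gives `‖h_S‖₁ ≤ (4s/9) ‖h_{Sᶜ}‖₁` once `4s ≤ 4^L`. For the sign vector it then gives `|⟨sgn x, h⟩| ≤
(4/9) ‖h_{Sᶜ}‖₁`, which is the strict dual inequality behind unique `ℓ¹` recovery
(`isUniqueL1Min_of_golfGood`). Hence `L` is of order `ln s`, and a union bound over rounds,
coordinates and at most `n + 1` initial vectors needs `q` of order `γ ln (n/ε)`. All initial vectors
are determined by `(S, x)`, so independence permits fixing that pair first
(`mul_measureReal_le_of_indepFun`). -/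

namespace BlockCS

/-! ### A Bernstein-type tail bound for finite weighted averages -/

section Tail

variable {α : Type*} [Fintype α]

/-- Total weight of the event `Q`. -/
noncomputable def wt (p : α → ℝ) (Q : α → Prop) : ℝ := by
  classical exact ∑ a, if Q a then p a else 0

theorem wt_mono {p : α → ℝ} (hp : ∀ a, 0 ≤ p a) {Q R : α → Prop} (h : ∀ a, Q a → R a) :
    wt p Q ≤ wt p R := by
  classical
  unfold wt
  refine Finset.sum_le_sum fun a _ => ?_
  by_cases hQ : Q a
  · simp [hQ, h a hQ]
  · simp only [hQ, if_false]
    split_ifs <;> simp [hp a]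

theorem wt_nonneg {p : α → ℝ} (hp : ∀ a, 0 ≤ p a) (Q : α → Prop) : 0 ≤ wt p Q := by
  classical
  unfold wt
  refine Finset.sum_nonneg fun a _ => ?_
  split_ifs <;> simp [hp a]

theorem wt_or_le {p : α → ℝ} (hp : ∀ a, 0 ≤ p a) (Q R : α → Prop) :
    wt p (fun a => Q a ∨ R a) ≤ wt p Q + wt p R := by
  classical
  unfold wt
  rw [← Finset.sum_add_distrib]
  refine Finset.sum_le_sum fun a _ => ?_
  by_cases hQ : Q a <;> by_cases hR : R a <;> simp [hQ, hR, hp a]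

theorem wt_exists_le {p : α → ℝ} (hp : ∀ a, 0 ≤ p a) {ι : Type*} [Fintype ι]
    (Q : ι → α → Prop) : wt p (fun a => ∃ i, Q i a) ≤ ∑ i, wt p (Q i) := by
  classical
  unfold wt
  rw [Finset.sum_comm]
  refine Finset.sum_le_sum fun a _ => ?_
  split_ifs with h
  · obtain ⟨i, hi⟩ := h
    calc p a = if Q i a then p a else 0 := by simp [hi]
      _ ≤ _ := Finset.single_le_sum (f := fun i => if Q i a then p a else 0)
        (fun j _ => by split_ifs <;> simp [hp a]) (Finset.mem_univ i)
  · exact Finset.sum_nonneg fun j _ => by split_ifs <;> simp [hp a]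

theorem wt_not {p : α → ℝ} (h1 : ∑ a, p a = 1) (Q : α → Prop) :
    wt p Q = 1 - wt p (fun a => ¬ Q a) := by
  classical
  unfold wt
  rw [eq_sub_iff_add_eq, ← Finset.sum_add_distrib, ← h1]
  refine Finset.sum_congr rfl fun a _ => ?_
  by_cases hQ : Q a <;> simp [hQ]

theorem wt_false (p : α → ℝ) {Q : α → Prop} (h : ∀ a, ¬ Q a) : wt p Q = 0 := by
  classical
  unfold wt
  exact Finset.sum_eq_zero fun a _ => by simp [h a]

/-- The product weight on `q`-tuples. -/
def prodWt (p : α → ℝ) (q : ℕ) (x : Fin q → α) : ℝ := ∏ l, p (x l)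

theorem prodWt_nonneg {β : Type*} {p : β → ℝ} (hp : ∀ a, 0 ≤ p a) (q : ℕ) (x : Fin q → β) :
    0 ≤ prodWt p q x := Finset.prod_nonneg fun _ _ => hp _

/-- Distributivity: independence in the form that factors the exponential moment. -/
theorem sum_prodWt_mul_prod (p g : α → ℝ) (q : ℕ) :
    ∑ x, prodWt p q x * ∏ l, g (x l) = (∑ a, p a * g a) ^ q := by
  classical
  simp only [prodWt, ← Finset.prod_mul_distrib]
  rw [← Fin.prod_const, Finset.prod_univ_sum]
  simp

theorem sum_prodWt {p : α → ℝ} (h1 : ∑ a, p a = 1) (q : ℕ) : ∑ x, prodWt p q x = 1 := by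
  have := sum_prodWt_mul_prod p (fun _ => 1) q
  simpa [h1] using this

/-- Markov's inequality for the exponential moment of a sum of independent centred variables. -/
theorem wt_sum_gt_le {p : α → ℝ} (hp : ∀ a, 0 ≤ p a) (h1 : ∑ a, p a = 1) {f : α → ℝ}
    {b V t r : ℝ} (hmean : ∑ a, p a * f a = 0) (hb : ∀ a, |f a| ≤ b)
    (hV : ∑ a, p a * f a ^ 2 ≤ V) (hr : 0 ≤ r) (hrb : r * b ≤ 1) (q : ℕ) :
    wt (prodWt p q) (fun x => q * t < ∑ l, f (x l)) ≤ Real.exp (q * (r ^ 2 * V - r * t)) := by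
  classical
  have hmgf : ∑ a, p a * Real.exp (r * f a) ≤ Real.exp (r ^ 2 * V) := by
    have hpt : ∀ a, p a * Real.exp (r * f a) ≤ p a * (1 + r * f a + (r * f a) ^ 2) := by
      intro a
      refine mul_le_mul_of_nonneg_left ?_ (hp a)
      have hle : |r * f a| ≤ 1 := by
        rw [abs_mul, abs_of_nonneg hr]
        exact (mul_le_mul_of_nonneg_left (hb a) hr).trans hrb
      -- For `|u| ≤ 1` one has `exp u ≤ 1 + u + u²`; this is where `r * b ≤ 1` enters.
      have := (abs_le.1 (Real.abs_exp_sub_one_sub_id_le hle)).2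
      linarith
    calc ∑ a, p a * Real.exp (r * f a) ≤ ∑ a, p a * (1 + r * f a + (r * f a) ^ 2) :=
          Finset.sum_le_sum fun a _ => hpt a
      _ = (∑ a, p a) + r * (∑ a, p a * f a) + r ^ 2 * ∑ a, p a * f a ^ 2 := by
          rw [Finset.mul_sum, Finset.mul_sum, ← Finset.sum_add_distrib, ← Finset.sum_add_distrib]
          exact Finset.sum_congr rfl fun a _ => by ring
      _ ≤ 1 + r ^ 2 * V := by
          rw [h1, hmean]
          nlinarith [mul_le_mul_of_nonneg_left hV (sq_nonneg r)]
      _ ≤ _ := by linarith [Real.add_one_le_exp (r ^ 2 * V)]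
  have hnn : 0 ≤ ∑ a, p a * Real.exp (r * f a) :=
    Finset.sum_nonneg fun a _ => mul_nonneg (hp a) (Real.exp_pos _).le
  calc wt (prodWt p q) (fun x => q * t < ∑ l, f (x l))
      ≤ ∑ x, prodWt p q x * (∏ l, Real.exp (r * f (x l))) * Real.exp (-(r * (q * t))) := by
        unfold wt
        refine Finset.sum_le_sum fun x _ => ?_
        have h0 := prodWt_nonneg hp q x
        split_ifs with h
        · rw [mul_assoc, ← Real.exp_sum, ← Real.exp_add, ← Finset.mul_sum]
          refine le_mul_of_one_le_right h0 (Real.one_le_exp ?_)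
          nlinarith [mul_le_mul_of_nonneg_left h.le hr]
        · positivity
    _ = (∑ a, p a * Real.exp (r * f a)) ^ q * Real.exp (-(r * (q * t))) := by
        rw [← Finset.sum_mul, sum_prodWt_mul_prod p (fun a => Real.exp (r * f a))]
    _ ≤ Real.exp (r ^ 2 * V) ^ q * Real.exp (-(r * (q * t))) := by gcongr
    _ = _ := by
        rw [← Real.exp_nat_mul, ← Real.exp_add]
        congr 1
        ring

/-- Tail bound for a real variable with sup norm and second moment at most `γ`, one sided. -/
theorem wt_mean_dev_le {p : α → ℝ} (hp : ∀ a, 0 ≤ p a) (h1 : ∑ a, p a = 1) {Y : α → ℝ}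
    {γ y : ℝ} (hγ : 0 < γ) (hmean : ∑ a, p a * Y a = y) (hb : ∀ a, |Y a| ≤ γ)
    (hV : ∑ a, p a * Y a ^ 2 ≤ γ) (q : ℕ) :
    wt (prodWt p q) (fun x => q * (1 / 8) < ∑ l, (Y (x l) - y)) ≤
      Real.exp (-(q / (256 * γ))) := by
  have hy : |y| ≤ γ := by
    rw [← hmean]
    calc |∑ a, p a * Y a| ≤ ∑ a, |p a * Y a| := Finset.abs_sum_le_sum_abs _ _
      _ ≤ ∑ a, p a * γ := Finset.sum_le_sum fun a _ => by
          rw [abs_mul, abs_of_nonneg (hp a)]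
          exact mul_le_mul_of_nonneg_left (hb a) (hp a)
      _ = γ := by rw [← Finset.sum_mul, h1, one_mul]
  -- Centring doubles the sup bound to `2γ`. The value `r = t / (2V) = 1 / (16γ)` minimises `r² V -
  -- r t`, with minimum `-1 / (256γ)`.
  have h := wt_sum_gt_le (t := 1 / 8) (r := 1 / (16 * γ)) (b := 2 * γ) (V := γ)
    (f := fun a => Y a - y) hp h1 ?_ ?_ ?_ (by positivity) (by field_simp; norm_num) q
  · refine h.trans_eq ?_
    congr 1
    field_simp
    ring
  · simp only [mul_sub, Finset.sum_sub_distrib, hmean, ← Finset.sum_mul, h1]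
    ring
  · intro a
    have := abs_sub (Y a) y
    linarith [hb a]
  · have : ∑ a, p a * (Y a - y) ^ 2 = ∑ a, p a * Y a ^ 2 - y ^ 2 := by
      have h2 : ∑ a, p a * (Y a - y) ^ 2 =
          ∑ a, p a * Y a ^ 2 - 2 * y * (∑ a, p a * Y a) + y ^ 2 * ∑ a, p a := by
        rw [Finset.mul_sum, Finset.mul_sum, ← Finset.sum_sub_distrib, ← Finset.sum_add_distrib]
        exact Finset.sum_congr rfl fun a _ => by ring
      rw [h2, hmean, h1]
      ring
    rw [this]
    nlinarith [sq_nonneg y]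

/-- Two sided tail bound for the average of a complex variable. -/
theorem wt_complex_dev_le {p : α → ℝ} (hp : ∀ a, 0 ≤ p a) (h1 : ∑ a, p a = 1) {Y : α → ℂ}
    {γ : ℝ} {y : ℂ} (hγ : 0 < γ) (hmean : ∑ a, (p a : ℂ) * Y a = y) (hb : ∀ a, ‖Y a‖ ≤ γ)
    (hV : ∑ a, p a * ‖Y a‖ ^ 2 ≤ γ) {q : ℕ} (hq : 0 < q) :
    wt (prodWt p q) (fun x => 1 / 4 < ‖y - (1 / q : ℂ) * ∑ l, Y (x l)‖) ≤
      4 * Real.exp (-(q / (256 * γ))) := by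
  have hq' : (0 : ℝ) < q := by exact_mod_cast hq
  have hw := prodWt_nonneg hp q
  have hre : ∀ a, |(Y a).re| ≤ ‖Y a‖ := fun a => Complex.abs_re_le_norm _
  have him : ∀ a, |(Y a).im| ≤ ‖Y a‖ := fun a => Complex.abs_im_le_norm _
  have hmre : ∑ a, p a * (Y a).re = y.re := by
    rw [← hmean, Complex.re_sum]
    simp
  have hmim : ∑ a, p a * (Y a).im = y.im := by
    rw [← hmean, Complex.im_sum]
    simp
  have hVre : ∑ a, p a * (Y a).re ^ 2 ≤ γ := by
    refine le_trans (Finset.sum_le_sum fun a _ => ?_) hV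
    refine mul_le_mul_of_nonneg_left ?_ (hp a)
    rw [← sq_abs]
    exact pow_le_pow_left₀ (abs_nonneg _) (hre a) 2
  have hVim : ∑ a, p a * (Y a).im ^ 2 ≤ γ := by
    refine le_trans (Finset.sum_le_sum fun a _ => ?_) hV
    refine mul_le_mul_of_nonneg_left ?_ (hp a)
    rw [← sq_abs]
    exact pow_le_pow_left₀ (abs_nonneg _) (him a) 2
  have e1 := wt_mean_dev_le (y := y.re) (Y := fun a => (Y a).re) hp h1 hγ hmre
    (fun a => (hre a).trans (hb a)) hVre q
  have e2 := wt_mean_dev_le (y := -y.re) (Y := fun a => -(Y a).re) hp h1 hγ (by simp [hmre])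
    (fun a => by simpa using (hre a).trans (hb a)) (by simpa using hVre) q
  have e3 := wt_mean_dev_le (y := y.im) (Y := fun a => (Y a).im) hp h1 hγ hmim
    (fun a => (him a).trans (hb a)) hVim q
  have e4 := wt_mean_dev_le (y := -y.im) (Y := fun a => -(Y a).im) hp h1 hγ (by simp [hmim])
    (fun a => by simpa using (him a).trans (hb a)) (by simpa using hVim) q
  -- A modulus above `1/4` forces the real or imaginary part beyond `1/8`, with one of two signs:
  -- hence the factor 4.
  have hsub := wt_mono (p := prodWt p q) hw
    (Q := fun x => 1 / 4 < ‖y - (1 / q : ℂ) * ∑ l, Y (x l)‖)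
    (R := fun x => ((q * (1 / 8) < ∑ l, ((Y (x l)).re - y.re)) ∨
      (q * (1 / 8) < ∑ l, (-(Y (x l)).re - -y.re))) ∨
      ((q * (1 / 8) < ∑ l, ((Y (x l)).im - y.im)) ∨
      (q * (1 / 8) < ∑ l, (-(Y (x l)).im - -y.im)))) (by
        intro x hx
        by_contra hcon
        push Not at hcon
        obtain ⟨⟨c1, c2⟩, c3, c4⟩ := hcon
        refine absurd hx (not_lt.2 ((Complex.norm_le_abs_re_add_abs_im _).trans ?_))
        have hz : (1 / q : ℂ) = ((1 / q : ℝ) : ℂ) := by push_cast; rfl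
        rw [hz, Complex.sub_re, Complex.sub_im, Complex.re_ofReal_mul, Complex.im_ofReal_mul,
          Complex.re_sum, Complex.im_sum]
        simp only [Finset.sum_sub_distrib, Finset.sum_neg_distrib, Finset.sum_const,
          Finset.card_univ, Fintype.card_fin, nsmul_eq_mul] at c1 c2 c3 c4
        have a1 : |y.re - 1 / q * ∑ l, (Y (x l)).re| ≤ 1 / 8 := by
          have : y.re - 1 / q * ∑ l, (Y (x l)).re = (q * y.re - ∑ l, (Y (x l)).re) / q := by
            field_simp
          rw [this, abs_div, abs_of_pos hq', div_le_iff₀ hq', abs_le]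
          constructor <;> linarith
        have a2 : |y.im - 1 / q * ∑ l, (Y (x l)).im| ≤ 1 / 8 := by
          have : y.im - 1 / q * ∑ l, (Y (x l)).im = (q * y.im - ∑ l, (Y (x l)).im) / q := by
            field_simp
          rw [this, abs_div, abs_of_pos hq', div_le_iff₀ hq', abs_le]
          constructor <;> linarith
        linarith)
  refine hsub.trans ((wt_or_le hw _ _).trans ?_)
  have o1 := wt_or_le hw (fun x => q * (1 / 8) < ∑ l, ((Y (x l)).re - y.re))
    (fun x => q * (1 / 8) < ∑ l, (-(Y (x l)).re - -y.re))
  have o2 := wt_or_le hw (fun x => q * (1 / 8) < ∑ l, ((Y (x l)).im - y.im))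
    (fun x => q * (1 / 8) < ∑ l, (-(Y (x l)).im - -y.im))
  linarith

end Tail

/-! ### Iterated independent rounds -/

section Rounds

variable {X V : Type*}

/-- All rounds succeed when the state `v` is updated by `T` between rounds. -/
def RoundsGood (T : X → V → V) (good : X → V → Prop) : (L : ℕ) → (Fin L → X) → V → Prop
  | 0, _, _ => True
  | L + 1, xs, v => good (xs 0) v ∧ RoundsGood T good L (Fin.tail xs) (T (xs 0) v)

/-- Condition on the first round: its failure costs `δ`. Otherwise the updated state is a fixed
vector for the remaining independent rounds, so induction applies; `inv` ensures that `δ` bounds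
every state reached. -/
theorem wt_not_roundsGood_le [Fintype X] {p : X → ℝ} (hp : ∀ a, 0 ≤ p a) (h1 : ∑ a, p a = 1)
    (T : X → V → V) (good : X → V → Prop) (inv : V → Prop) (hT : ∀ a v, inv v → inv (T a v))
    {δ : ℝ} (hδ : ∀ v, inv v → wt p (fun a => ¬ good a v) ≤ δ) (L : ℕ) (v : V) (hv : inv v) :
    wt (prodWt p L) (fun xs => ¬ RoundsGood T good L xs v) ≤ L * δ := by
  classical
  induction L generalizing v with
  | zero => simp [RoundsGood, wt_false]
  | succ L ih =>
    have hδ0 : 0 ≤ δ := (wt_nonneg hp _).trans (hδ v hv)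
    have key : wt (prodWt p (L + 1)) (fun xs => ¬ RoundsGood T good (L + 1) xs v) =
        ∑ a, p a * wt (prodWt p L)
          (fun xs => ¬ (good a v ∧ RoundsGood T good L xs (T a v))) := by
      unfold wt
      simp only [Finset.mul_sum]
      rw [← Fintype.sum_prod_type', ← Equiv.sum_comp (Fin.consEquiv fun _ => X)]
      refine Finset.sum_congr rfl fun a _ => ?_
      simp [RoundsGood, Fin.consEquiv, prodWt, Fin.prod_univ_succ]
    rw [key]
    have hstep : ∀ a, p a * wt (prodWt p L)
        (fun xs => ¬ (good a v ∧ RoundsGood T good L xs (T a v))) ≤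
        (if ¬ good a v then p a else 0) + p a * (L * δ) := by
      intro a
      by_cases hg : good a v
      · simp only [hg, true_and, not_true, if_false, zero_add]
        exact mul_le_mul_of_nonneg_left (ih _ (hT a v hv)) (hp a)
      · have hle : wt (prodWt p L)
            (fun xs => ¬ (good a v ∧ RoundsGood T good L xs (T a v))) ≤ 1 := by
          have := wt_not (sum_prodWt h1 L)
            (fun xs => ¬ (good a v ∧ RoundsGood T good L xs (T a v)))
          rw [this]
          linarith [wt_nonneg (prodWt_nonneg hp L)
            (fun xs => ¬ ¬ (good a v ∧ RoundsGood T good L xs (T a v)))]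
        rw [if_pos hg]
        have := mul_le_mul_of_nonneg_left hle (hp a)
        have h2 : 0 ≤ p a * (L * δ) := by have := hp a; positivity
        linarith
    refine (Finset.sum_le_sum fun a _ => hstep a).trans ?_
    rw [Finset.sum_add_distrib, ← Finset.sum_mul, h1]
    have : (∑ a, if ¬ good a v then p a else 0) ≤ δ := by
      convert hδ v hv using 1
      unfold wt
      congr!
    push_cast
    linarith

end Rounds

/-! ### Consequences of a bound on `Γ` -/

section Blocks

variable {n M : ℕ}

/-- A real supremum over an unbounded family defaults to `0`, so boundedness must be checked before
`opNormInf` can serve as an upper bound. -/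
theorem bddAbove_norm_mulVec (B : Matrix (Fin n) (Fin n) ℂ) :
    BddAbove (Set.range fun v : {v : Fin n → ℂ // ‖v‖ ≤ 1} => ‖B *ᵥ v.1‖) := by
  refine ⟨‖LinearMap.toContinuousLinearMap B.mulVecLin‖, ?_⟩
  rintro _ ⟨v, rfl⟩
  have := (LinearMap.toContinuousLinearMap B.mulVecLin).le_opNorm_of_le v.2
  simpa using this

theorem norm_mulVec_le_opNormInf (B : Matrix (Fin n) (Fin n) ℂ) {v : Fin n → ℂ} (hv : ‖v‖ ≤ 1) :
    ‖B *ᵥ v‖ ≤ opNormInf B :=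
  le_ciSup (bddAbove_norm_mulVec B) ⟨v, hv⟩

theorem norm_single_one_le (i : Fin n) : ‖(Pi.single i 1 : Fin n → ℂ)‖ ≤ 1 := by
  simp [Pi.norm_single]

variable {A₀ : Matrix (Fin n) (Fin n) ℂ} {I : Fin M → Finset (Fin n)} {π : Fin M → ℝ}
  {S : Set (Fin n)} {γ : ℝ}

theorem norm_blockGram_mulVec_le (hπ : ∀ k, 0 < π k) (hΓ : Gam A₀ I π S ≤ γ) {v : Fin n → ℂ}
    (hv : ‖v‖ ≤ 1) (k : Fin M) (i : Fin n) : 1 / π k * ‖(blockGram A₀ I S k *ᵥ v) i‖ ≤ γ := by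
  refine le_trans ?_ ((le_max_right _ _).trans hΓ)
  refine le_trans ?_ (le_ciSup (f := fun k => 1 / π k * opNormInf (blockGram A₀ I S k))
    (Set.finite_range _).bddAbove k)
  have := hπ k
  have h2 := (norm_le_pi_norm (blockGram A₀ I S k *ᵥ v) i).trans (norm_mulVec_le_opNormInf _ hv)
  gcongr

theorem sum_blockGram_mulVec_sq_le (hπ : ∀ k, 0 < π k) (hΓ : Gam A₀ I π S ≤ γ)
    {v : Fin n → ℂ} (hv : ‖v‖ ≤ 1) (i : Fin n) :
    ∑ k, 1 / π k * ‖(blockGram A₀ I S k *ᵥ v) i‖ ^ 2 ≤ γ := by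
  refine le_trans ?_ ((le_max_left _ _).trans hΓ)
  refine le_trans ?_ (le_ciSup (f := fun i => ⨆ v : {v : Fin n → ℂ // ‖v‖ ≤ 1},
    ∑ k, 1 / π k * ‖(blockGram A₀ I S k *ᵥ v.1) i‖ ^ 2) (Set.finite_range _).bddAbove i)
  refine le_ciSup (f := fun v : {v : Fin n → ℂ // ‖v‖ ≤ 1} =>
    ∑ k, 1 / π k * ‖(blockGram A₀ I S k *ᵥ v.1) i‖ ^ 2) ?_ ⟨v, hv⟩
  refine ⟨∑ k, 1 / π k * opNormInf (blockGram A₀ I S k) ^ 2, ?_⟩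
  rintro _ ⟨w, rfl⟩
  refine Finset.sum_le_sum fun k _ => ?_
  have := hπ k
  have h2 := (norm_le_pi_norm (blockGram A₀ I S k *ᵥ w.1) i).trans
    (norm_mulVec_le_opNormInf _ w.2)
  gcongr

theorem projS_mulVec {v : Fin n → ℂ} (hv : ∀ i, i ∉ S → v i = 0) : projS S *ᵥ v = v := by
  classical
  ext i
  by_cases hi : i ∈ S <;> simp [projS, Matrix.mulVec_diagonal, hi, hv]

theorem blockGram_mulVec (k : Fin M) {v : Fin n → ℂ} (hv : ∀ i, i ∉ S → v i = 0) :
    blockGram A₀ I S k *ᵥ v = (block A₀ I k)ᴴ *ᵥ (block A₀ I k *ᵥ v) := by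
  rw [blockGram, ← Matrix.mulVec_mulVec, ← Matrix.mulVec_mulVec, projS_mulVec hv]

/-- The blocks of a unitary matrix form a tight frame. -/
theorem sum_blockGram_mulVec (hA : A₀ ∈ Matrix.unitaryGroup (Fin n) ℂ)
    (hI : ∀ i : Fin n, ∃! k : Fin M, i ∈ I k) {v : Fin n → ℂ} (hv : ∀ i, i ∉ S → v i = 0) :
    ∑ k, blockGram A₀ I S k *ᵥ v = v := by
  classical
  have hU : A₀ᴴ * A₀ = 1 := Matrix.mem_unitaryGroup_iff'.1 hA
  have hv' : v = A₀ᴴ *ᵥ (A₀ *ᵥ v) := by rw [Matrix.mulVec_mulVec, hU, Matrix.one_mulVec]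
  conv_rhs => rw [hv']
  ext j
  simp only [blockGram_mulVec _ hv, Finset.sum_apply]
  set u := A₀ *ᵥ v with hu
  have hblock : ∀ k, ((block A₀ I k)ᴴ *ᵥ (block A₀ I k *ᵥ v)) j =
      ∑ i, if i ∈ I k then A₀ᴴ j i * u i else 0 := by
    intro k
    rw [← Finset.sum_filter, Finset.filter_mem_eq_inter, Finset.univ_inter,
      ← Finset.sum_coe_sort]
    rfl
  simp only [hblock]
  rw [Finset.sum_comm]
  refine Finset.sum_congr rfl fun i _ => ?_
  obtain ⟨k, hk, huniq⟩ := hI i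
  rw [Finset.sum_eq_single k]
  · simp [hk]
  · intro b _ hb
    rw [if_neg fun h => hb (huniq b h)]
  · simp

/-- The image of `B_k^*` is orthogonal to the kernel of `B_k`. Hence a golfing correction never
changes the pairing with a kernel vector. -/
theorem star_blockGram_mulVec_dotProduct (k : Fin M) {v h : Fin n → ℂ}
    (hv : ∀ i, i ∉ S → v i = 0) (hh : block A₀ I k *ᵥ h = 0) :
    star (blockGram A₀ I S k *ᵥ v) ⬝ᵥ h = 0 := by
  rw [blockGram_mulVec k hv, Matrix.star_mulVec, Matrix.conjTranspose_conjTranspose,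
    ← Matrix.dotProduct_mulVec, hh, dotProduct_zero]

/-- On a non-empty support the quantity `Γ` is at least one. -/
theorem one_le_of_Gam_le (hA : A₀ ∈ Matrix.unitaryGroup (Fin n) ℂ)
    (hI : ∀ i : Fin n, ∃! k : Fin M, i ∈ I k) (hπ : ∀ k, 0 < π k) (hπ1 : ∑ k, π k = 1)
    (hΓ : Gam A₀ I π S ≤ γ) (hS : S.Nonempty) : 1 ≤ γ := by
  classical
  obtain ⟨i, hi⟩ := hS
  set v : Fin n → ℂ := Pi.single i 1 with hvdef
  have hv : ∀ j, j ∉ S → v j = 0 := fun j hj => by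
    rw [hvdef, Pi.single_eq_of_ne]
    rintro rfl
    exact hj hi
  have hv1 : ‖v‖ ≤ 1 := norm_single_one_le i
  have hsum := congrFun (sum_blockGram_mulVec (A₀ := A₀) hA hI hv) i
  rw [Finset.sum_apply] at hsum
  have h1 : (1 : ℝ) ≤ ∑ k, ‖(blockGram A₀ I S k *ᵥ v) i‖ := by
    refine le_trans ?_ (norm_sum_le _ _)
    rw [hsum]
    simp [hvdef]
  -- Cauchy–Schwarz with weights `π`: `1 ≤ (∑ |y_k|)² ≤ (∑ π_k) (∑ |y_k|² / π_k) ≤ γ`.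
  have hcs := Finset.sum_sq_le_sum_mul_sum_of_sq_le_mul Finset.univ
    (r := fun k => ‖(blockGram A₀ I S k *ᵥ v) i‖) (f := π)
    (g := fun k => 1 / π k * ‖(blockGram A₀ I S k *ᵥ v) i‖ ^ 2) (fun k _ => (hπ k).le)
    (fun k _ => by have := hπ k; positivity) (fun k _ => by have := (hπ k).ne'; field_simp; rfl)
  rw [hπ1, one_mul] at hcs
  have := sum_blockGram_mulVec_sq_le hπ hΓ hv1 i
  nlinarith

/-! ### The golfing iteration -/

/-- `v - H v`, where `H` is the empirical mean of `B_k^* B_{k,S} / π_k` over one round `x`. -/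
noncomputable def resid (A₀ : Matrix (Fin n) (Fin n) ℂ) (I : Fin M → Finset (Fin n))
    (π : Fin M → ℝ) (S : Set (Fin n)) {q : ℕ} (x : Fin q → Fin M) (v : Fin n → ℂ) : Fin n → ℂ :=
  v - (1 / q : ℂ) • ∑ l, ((1 / π (x l) : ℝ) : ℂ) • (blockGram A₀ I S (x l) *ᵥ v)

/-- The state of the golfing iteration after one round. -/
noncomputable def golfStep (A₀ : Matrix (Fin n) (Fin n) ℂ) (I : Fin M → Finset (Fin n))
    (π : Fin M → ℝ) (S : Set (Fin n)) {q : ℕ} (x : Fin q → Fin M) (v : Fin n → ℂ) : Fin n → ℂ :=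
  S.indicator (resid A₀ I π S x v)

/-- All `L` rounds of the golfing iteration contract the sup norm by a factor `4`. -/
def GolfGood (A₀ : Matrix (Fin n) (Fin n) ℂ) (I : Fin M → Finset (Fin n))
    (π : Fin M → ℝ) (S : Set (Fin n)) {q : ℕ} (L : ℕ) (xs : Fin L → Fin q → Fin M)
    (v : Fin n → ℂ) : Prop :=
  RoundsGood (golfStep A₀ I π S) (fun x v => ‖resid A₀ I π S x v‖ ≤ 1 / 4 * ‖v‖) L xs v

theorem golfStep_eq_zero {q : ℕ} (x : Fin q → Fin M) (v : Fin n → ℂ) (i : Fin n) (hi : i ∉ S) :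
    golfStep A₀ I π S x v i = 0 := Set.indicator_of_notMem hi _

theorem resid_smul {q : ℕ} (x : Fin q → Fin M) (c : ℂ) (v : Fin n → ℂ) :
    resid A₀ I π S x (c • v) = c • resid A₀ I π S x v := by
  simp only [resid, Matrix.mulVec_smul, smul_sub, Finset.smul_sum]
  congr 1
  refine Finset.sum_congr rfl fun l _ => ?_
  simp only [smul_smul]
  congr 1
  ring

theorem continuous_resid {q : ℕ} (x : Fin q → Fin M) : Continuous (resid A₀ I π S x) := by
  unfold resid
  have h : ∀ k, Continuous fun v : Fin n → ℂ => blockGram A₀ I S k *ᵥ v := fun k =>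
    Continuous.matrix_mulVec continuous_const continuous_id
  fun_prop

theorem continuous_golfStep {q : ℕ} (x : Fin q → Fin M) : Continuous (golfStep A₀ I π S x) := by
  classical
  refine continuous_pi fun i => ?_
  by_cases hi : i ∈ S
  · simpa [golfStep, hi, Function.comp_def] using
      (continuous_apply i).comp (continuous_resid (A₀ := A₀) (I := I) (π := π) (S := S) x)
  · simpa [golfStep, hi] using continuous_const

/-- Closedness supplies the measurability of golfing success as a condition on the random sign
vector. -/
theorem isClosed_golfGood {q : ℕ} (L : ℕ) (xs : Fin L → Fin q → Fin M) :
    IsClosed {v | GolfGood A₀ I π S L xs v} := by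
  induction L with
  | zero => simp [GolfGood, RoundsGood]
  | succ L ih =>
    have h1 : IsClosed {v | ‖resid A₀ I π S (xs 0) v‖ ≤ 1 / 4 * ‖v‖} :=
      isClosed_le (continuous_resid _).norm (continuous_const.mul continuous_norm)
    exact h1.inter ((ih (Fin.tail xs)).preimage (continuous_golfStep (xs 0)))

/-- One round fails to contract a given vector only with small probability. -/
theorem wt_resid_le (hA : A₀ ∈ Matrix.unitaryGroup (Fin n) ℂ)
    (hI : ∀ i : Fin n, ∃! k : Fin M, i ∈ I k) (hπ : ∀ k, 0 < π k) (hπ1 : ∑ k, π k = 1)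
    (hγ : 0 < γ) (hΓ : Gam A₀ I π S ≤ γ) {q : ℕ} (hq : 0 < q) {v : Fin n → ℂ}
    (hv : ∀ i, i ∉ S → v i = 0) :
    wt (prodWt π q) (fun x => ¬ ‖resid A₀ I π S x v‖ ≤ 1 / 4 * ‖v‖) ≤
      n * (4 * Real.exp (-(q / (256 * γ)))) := by
  have hw := prodWt_nonneg (fun k => (hπ k).le) q
  rcases eq_or_ne v 0 with rfl | hv0
  · rw [wt_false]
    · positivity
    · intro x
      have := resid_smul (A₀ := A₀) (I := I) (π := π) (S := S) x 0 0
      simp only [zero_smul] at this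
      simp [this]
  have hvpos : 0 < ‖v‖ := norm_pos_iff.2 hv0
  -- `Γ` controls only the unit ball; homogeneity of `resid` allows normalising `v`.
  set c : ℂ := ((‖v‖⁻¹ : ℝ) : ℂ) with hc
  set w : Fin n → ℂ := c • v with hwdef
  have hcn : ‖c‖ = ‖v‖⁻¹ := by rw [hc, Complex.norm_real, Real.norm_of_nonneg (by positivity)]
  have hw1 : ‖w‖ ≤ 1 := by rw [hwdef, norm_smul, hcn, inv_mul_cancel₀ hvpos.ne']
  have hwS : ∀ i, i ∉ S → w i = 0 := fun i hi => by simp [hwdef, hv i hi]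
  have hcoord : ∀ i, wt (prodWt π q) (fun x => 1 / 4 < ‖resid A₀ I π S x w i‖) ≤
      4 * Real.exp (-(q / (256 * γ))) := by
    intro i
    have := wt_complex_dev_le (p := π) (fun k => (hπ k).le) hπ1
      (Y := fun k => ((1 / π k : ℝ) : ℂ) * (blockGram A₀ I S k *ᵥ w) i) (y := w i) hγ ?_ ?_ ?_ hq
    · convert this using 5 with x
      simp [resid]
    · rw [← congrFun (sum_blockGram_mulVec hA hI hwS) i, Finset.sum_apply]
      refine Finset.sum_congr rfl fun k _ => ?_
      rw [← mul_assoc, ← Complex.ofReal_mul, mul_one_div_cancel (hπ k).ne']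
      simp
    · intro k
      rw [norm_mul, Complex.norm_real, Real.norm_of_nonneg (by have := hπ k; positivity)]
      exact norm_blockGram_mulVec_le hπ hΓ hw1 k i
    · refine le_of_eq_of_le (Finset.sum_congr rfl fun k _ => ?_)
        (sum_blockGram_mulVec_sq_le hπ hΓ hw1 i)
      have := hπ k
      rw [norm_mul, Complex.norm_real, Real.norm_of_nonneg (by positivity)]
      field_simp
  calc wt (prodWt π q) (fun x => ¬ ‖resid A₀ I π S x v‖ ≤ 1 / 4 * ‖v‖)
      ≤ wt (prodWt π q) (fun x => ∃ i, 1 / 4 < ‖resid A₀ I π S x w i‖) := by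
        refine wt_mono hw fun x hx => ?_
        by_contra hcon
        push Not at hcon
        refine hx ?_
        have hb : ‖resid A₀ I π S x w‖ ≤ 1 / 4 := (pi_norm_le_iff_of_nonneg (by norm_num)).2 hcon
        rw [hwdef, resid_smul, norm_smul, hcn, inv_mul_le_iff₀ hvpos] at hb
        linarith
    _ ≤ ∑ i, wt (prodWt π q) (fun x => 1 / 4 < ‖resid A₀ I π S x w i‖) :=
        wt_exists_le hw _
    _ ≤ ∑ _i : Fin n, 4 * Real.exp (-(q / (256 * γ))) := Finset.sum_le_sum fun i _ => hcoord i
    _ = _ := by simp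

theorem wt_not_golfGood_le (hA : A₀ ∈ Matrix.unitaryGroup (Fin n) ℂ)
    (hI : ∀ i : Fin n, ∃! k : Fin M, i ∈ I k) (hπ : ∀ k, 0 < π k) (hπ1 : ∑ k, π k = 1)
    (hγ : 0 < γ) (hΓ : Gam A₀ I π S ≤ γ) {q : ℕ} (hq : 0 < q) (L : ℕ) {v : Fin n → ℂ}
    (hv : ∀ i, i ∉ S → v i = 0) :
    wt (prodWt (prodWt π q) L) (fun xs => ¬ GolfGood A₀ I π S L xs v) ≤
      L * (n * (4 * Real.exp (-(q / (256 * γ))))) :=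
  wt_not_roundsGood_le (prodWt_nonneg (fun k => (hπ k).le) q) (sum_prodWt hπ1 q)
    (golfStep A₀ I π S) _ (fun v => ∀ i, i ∉ S → v i = 0)
    (fun x v _ => golfStep_eq_zero x v)
    (fun _ hv => wt_resid_le hA hI hπ hπ1 hγ hΓ hq hv) L v hv

theorem golfGood_zero {q : ℕ} (L : ℕ) (xs : Fin L → Fin q → Fin M) :
    GolfGood A₀ I π S L xs 0 := by
  have hr : ∀ x : Fin q → Fin M, resid A₀ I π S x 0 = 0 := fun x => by
    have := resid_smul (A₀ := A₀) (I := I) (π := π) (S := S) x 0 0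
    simpa only [zero_smul] using this
  induction L with
  | zero => trivial
  | succ L ih =>
    refine ⟨by simp [hr], ?_⟩
    have : golfStep A₀ I π S (xs 0) 0 = 0 := by
      unfold golfStep
      rw [hr]
      exact Set.indicator_zero _ _
    rw [this]
    exact ih _

/-! ### From golfing to recovery -/

theorem norm_star_dotProduct_le (v h : Fin n → ℂ) : ‖star v ⬝ᵥ h‖ ≤ ‖v‖ * ∑ i, ‖h i‖ := by
  rw [dotProduct, Finset.mul_sum]
  refine (norm_sum_le _ _).trans (Finset.sum_le_sum fun i _ => ?_)
  rw [norm_mul, Pi.star_apply, norm_star]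
  exact mul_le_mul_of_nonneg_right (norm_le_pi_norm v i) (norm_nonneg _)

theorem norm_indicator_le (T : Set (Fin n)) (v : Fin n → ℂ) : ‖T.indicator v‖ ≤ ‖v‖ :=
  (pi_norm_le_iff_of_nonneg (norm_nonneg _)).2 fun i =>
    (norm_indicator_le_norm_self v i).trans (norm_le_pi_norm v i)

theorem star_dotProduct_indicator (T : Set (Fin n)) (v h : Fin n → ℂ) :
    star (T.indicator v) ⬝ᵥ h = star (T.indicator v) ⬝ᵥ T.indicator h := by
  classical
  refine Finset.sum_congr rfl fun i _ => ?_
  by_cases hi : i ∈ T <;> simp [hi]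

/-- After successful golfing, kernel vectors are almost orthogonal to the initial vector. -/
theorem GolfGood.norm_dotProduct_le {q L : ℕ} {xs : Fin L → Fin q → Fin M} {v : Fin n → ℂ}
    (hg : GolfGood A₀ I π S L xs v) (hv : ∀ i, i ∉ S → v i = 0) {h : Fin n → ℂ}
    (hh : ∀ j l, block A₀ I (xs j l) *ᵥ h = 0) :
    ‖star v ⬝ᵥ h‖ ≤ ‖v‖ * ((1 / 4) ^ L * ∑ i, ‖S.indicator h i‖ +
      1 / 3 * ∑ i, ‖Sᶜ.indicator h i‖) := by
  induction L generalizing v with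
  | zero =>
    have hvi : S.indicator v = v := Set.indicator_eq_self.2 fun i hi => by
      by_contra hcon
      exact hi (hv i hcon)
    rw [← hvi, star_dotProduct_indicator, hvi]
    refine (norm_star_dotProduct_le _ _).trans ?_
    refine mul_le_mul_of_nonneg_left ?_ (norm_nonneg _)
    have : 0 ≤ ∑ i, ‖Sᶜ.indicator h i‖ := Finset.sum_nonneg fun _ _ => norm_nonneg _
    rw [pow_zero]
    linarith
  | succ L ih =>
    obtain ⟨h1, h2⟩ := hg
    have hIH := ih (xs := Fin.tail xs) h2 (golfStep_eq_zero _ _) (fun j l => hh j.succ l)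
    set r := resid A₀ I π S (xs 0) v with hr
    set a := ∑ i, ‖S.indicator h i‖
    set b := ∑ i, ‖Sᶜ.indicator h i‖
    have ha : 0 ≤ a := Finset.sum_nonneg fun _ _ => norm_nonneg _
    have hb : 0 ≤ b := Finset.sum_nonneg fun _ _ => norm_nonneg _
    have hvr : star v ⬝ᵥ h = star r ⬝ᵥ h := by
      rw [hr, resid, star_sub, sub_dotProduct, star_smul, smul_dotProduct, star_sum,
        sum_dotProduct]
      rw [Finset.sum_eq_zero, smul_zero, sub_zero]
      intro l _
      rw [star_smul, smul_dotProduct, star_blockGram_mulVec_dotProduct _ hv (hh 0 l), smul_zero]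
    have hsplit : star r ⬝ᵥ h = star (golfStep A₀ I π S (xs 0) v) ⬝ᵥ h +
        star (Sᶜ.indicator r) ⬝ᵥ Sᶜ.indicator h := by
      rw [← star_dotProduct_indicator, golfStep, ← add_dotProduct, ← star_add,
        Set.indicator_self_add_compl]
    have hT : ‖golfStep A₀ I π S (xs 0) v‖ ≤ 1 / 4 * ‖v‖ := (norm_indicator_le _ _).trans h1
    have hO : ‖star (Sᶜ.indicator r) ⬝ᵥ Sᶜ.indicator h‖ ≤ 1 / 4 * ‖v‖ * b :=
      (norm_star_dotProduct_le _ _).trans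
        (mul_le_mul_of_nonneg_right ((norm_indicator_le _ _).trans h1) hb)
    rw [hvr, hsplit]
    refine (norm_add_le _ _).trans ((add_le_add hIH hO).trans ?_)
    have hnn : 0 ≤ (1 / 4 : ℝ) ^ L * a + 1 / 3 * b := by positivity
    have := mul_le_mul_of_nonneg_right hT hnn
    -- The constant `1/3` is the fixed point of `c = c/4 + 1/4`: a quarter from the contracted
    -- state, plus the new contribution off `S`.
    refine (add_le_add_left this _).trans (le_of_eq ?_)
    rw [pow_succ]
    ring

theorem block_mulVec_eq_zero {m : ℕ} (hπ : ∀ k, 0 < π k) {K : Fin m → Fin M} {h : Fin n → ℂ}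
    (hh : sensing A₀ I π K *ᵥ h = 0) (l : Fin m) : block A₀ I (K l) *ᵥ h = 0 := by
  ext i
  have h1 := congrFun hh ⟨l, i⟩
  have hm : (0 : ℝ) < m := by exact_mod_cast l.pos
  have hc : ((1 / √(m : ℝ) * (1 / √(π (K l))) : ℝ) : ℂ) ≠ 0 := by
    have := hπ (K l)
    rw [Complex.ofReal_ne_zero]
    positivity
  have h2 : (sensing A₀ I π K *ᵥ h) ⟨l, i⟩ =
      ((1 / √(m : ℝ) * (1 / √(π (K l))) : ℝ) : ℂ) * (block A₀ I (K l) *ᵥ h) i := by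
    simp only [Matrix.mulVec, dotProduct, Finset.mul_sum, sensing, Matrix.of_apply, mul_assoc]
  rw [h2] at h1
  exact (mul_eq_zero.1 h1).resolve_left hc

/-- The sign vector of `x`. -/
noncomputable def sgn (x : Fin n → ℂ) : Fin n → ℂ := fun i => x i / (‖x i‖ : ℂ)

theorem norm_sgn_apply_le (x : Fin n → ℂ) (i : Fin n) : ‖sgn x i‖ ≤ 1 := by
  simpa [sgn] using div_self_le_one ‖x i‖

theorem norm_sgn_le (x : Fin n → ℂ) : ‖sgn x‖ ≤ 1 :=
  (pi_norm_le_iff_of_nonneg zero_le_one).2 (norm_sgn_apply_le x)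

theorem star_sgn_mul (x : Fin n → ℂ) (i : Fin n) : star (sgn x i) * x i = ‖x i‖ := by
  rcases eq_or_ne (x i) 0 with h | h
  · simp [h]
  · have hn : (‖x i‖ : ℂ) ≠ 0 := by simpa using h
    simp only [sgn, Complex.star_def, map_div₀, Complex.conj_ofReal]
    rw [div_mul_eq_mul_div, Complex.conj_mul', pow_two, mul_div_assoc, div_self hn, mul_one]

/-- Successful golfing for the sign vector and for all coordinate vectors of the support
implies recovery. -/
theorem isUniqueL1Min_of_golfGood {m q L s : ℕ} (hπ : ∀ k, 0 < π k) {K : Fin m → Fin M}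
    (e : Fin L → Fin q → Fin m) {x : Fin n → ℂ} (hx : ∀ i, i ∉ S → x i = 0)
    (hS : S.ncard ≤ s) (hL : 4 * s ≤ 4 ^ L)
    (hsgn : GolfGood A₀ I π S L (fun j l => K (e j l)) (sgn x))
    (hcoord : ∀ i ∈ S, GolfGood A₀ I π S L (fun j l => K (e j l)) (Pi.single i 1)) :
    IsUniqueL1Min (sensing A₀ I π K) (sensing A₀ I π K *ᵥ x) x := by
  classical
  refine ⟨rfl, fun z hz hzx => ?_⟩
  set h : Fin n → ℂ := z - x with hh
  have hker : sensing A₀ I π K *ᵥ h = 0 := by rw [hh, Matrix.mulVec_sub, hz, sub_self]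
  have hblk : ∀ j l, block A₀ I (K (e j l)) *ᵥ h = 0 := fun j l =>
    block_mulVec_eq_zero hπ hker _
  set a := ∑ i, ‖S.indicator h i‖ with ha
  set b := ∑ i, ‖Sᶜ.indicator h i‖ with hb
  have ha0 : 0 ≤ a := Finset.sum_nonneg fun _ _ => norm_nonneg _
  have hb0 : 0 ≤ b := Finset.sum_nonneg fun _ _ => norm_nonneg _
  have hpow : 4 * (s : ℝ) * (1 / 4) ^ L ≤ 1 := by
    have : (4 * s : ℝ) ≤ 4 ^ L := by exact_mod_cast hL
    rw [one_div, inv_pow, ← div_eq_mul_inv, div_le_one (by positivity)]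
    exact this
  have hpow0 : (0 : ℝ) ≤ (1 / 4) ^ L := by positivity
  have hcoord' : ∀ i ∈ S, ‖h i‖ ≤ (1 / 4) ^ L * a + 1 / 3 * b := by
    intro i hi
    have := (hcoord i hi).norm_dotProduct_le (fun j hj => by
      rw [Pi.single_eq_of_ne]
      rintro rfl
      exact hj hi) hblk
    have hs : star (Pi.single i 1 : Fin n → ℂ) = Pi.single i 1 := by
      rw [← Pi.single_star, star_one]
    rw [hs, single_one_dotProduct] at this
    exact this.trans (mul_le_of_le_one_left (by positivity) (norm_single_one_le i))
  have hab : a ≤ s * ((1 / 4) ^ L * a + 1 / 3 * b) := by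
    have h1 : a = ∑ i ∈ S.toFinset, ‖h i‖ := by
      rw [ha, ← Finset.sum_subset (Finset.subset_univ S.toFinset)]
      · refine Finset.sum_congr rfl fun i hi => ?_
        rw [Set.indicator_of_mem (by simpa using hi)]
      · intro i _ hi
        rw [Set.indicator_of_notMem (by simpa using hi), norm_zero]
    have h2 := Finset.sum_le_card_nsmul S.toFinset (fun i => ‖h i‖)
      ((1 / 4) ^ L * a + 1 / 3 * b) fun i hi => hcoord' i (by simpa using hi)
    rw [← h1, nsmul_eq_mul, ← Set.ncard_eq_toFinset_card'] at h2
    refine h2.trans ?_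
    have : (S.ncard : ℝ) ≤ s := by exact_mod_cast hS
    gcongr
  -- Since `s * (1/4)^L ≤ 1/4`, the `a` term on the right of `hab` is absorbed.
  have hab' : 3 / 4 * a ≤ s / 3 * b := by nlinarith
  have hsg : ‖star (sgn x) ⬝ᵥ h‖ ≤ 4 / 9 * b := by
    have h1 := hsgn.norm_dotProduct_le (fun i hi => by simp [sgn, hx i hi]) hblk
    have h2 : ‖sgn x‖ * ((1 / 4) ^ L * a + 1 / 3 * b) ≤ 1 * ((1 / 4) ^ L * a + 1 / 3 * b) :=
      mul_le_mul_of_nonneg_right (norm_sgn_le x) (by positivity)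
    have h3 : (1 / 4) ^ L * a ≤ 1 / 9 * b := by
      have h4 := mul_le_mul_of_nonneg_left hab' hpow0
      have h5 := mul_le_mul_of_nonneg_right hpow hb0
      nlinarith
    linarith
  have hbpos : 0 < b := by
    refine lt_of_le_of_ne hb0 fun hb' => hzx ?_
    have ha' : a = 0 := by
      rw [← hb'] at hab'
      linarith
    have hzero : h = 0 := by
      ext i
      have e1 := (Finset.sum_eq_zero_iff_of_nonneg fun _ _ => norm_nonneg _).1 ha'
        i (Finset.mem_univ i)
      have e2 := (Finset.sum_eq_zero_iff_of_nonneg fun _ _ => norm_nonneg _).1 hb'.symm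
        i (Finset.mem_univ i)
      by_cases hi : i ∈ S
      · simpa [hi] using e1
      · simpa [hi] using e2
    exact sub_eq_zero.1 hzero
  -- On `S`, pair `z i` with the sign, of modulus at most 1. Off `S`, both `x` and its sign vanish,
  -- so `z i = h i`.
  have hpt : ∀ i, ‖x i‖ + (star (sgn x i) * h i).re + ‖Sᶜ.indicator h i‖ ≤ ‖z i‖ := by
    intro i
    by_cases hi : i ∈ S
    · have h1 : ‖x i‖ + (star (sgn x i) * h i).re = (star (sgn x i) * z i).re := by
        have : star (sgn x i) * z i = star (sgn x i) * h i + ‖x i‖ := by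
          rw [← star_sgn_mul x i, hh, Pi.sub_apply]
          ring
        rw [this, Complex.add_re, Complex.ofReal_re, add_comm]
      rw [h1, Set.indicator_of_notMem (by simpa using hi), norm_zero, add_zero]
      refine (Complex.re_le_norm _).trans ?_
      rw [norm_mul, norm_star]
      exact mul_le_of_le_one_left (norm_nonneg _) (norm_sgn_apply_le x i)
    · have hxi := hx i hi
      simp [sgn, hxi, hh, hi]
  have htot : l1Norm x + (star (sgn x) ⬝ᵥ h).re + b ≤ l1Norm z := by
    unfold l1Norm
    rw [dotProduct, Complex.re_sum, hb, ← Finset.sum_add_distrib, ← Finset.sum_add_distrib]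
    exact Finset.sum_le_sum fun i _ => hpt i
  have := (abs_le.1 ((Complex.abs_re_le_norm _).trans hsg)).1
  linarith

end Blocks

/-! ### Transfer to the probability space -/

/-- Applied with the finitely many subsets of `Fin n` as first factor, it reduces joint
measurability in `(S, x)` to fixed `S`. -/
theorem measurableSet_of_slices {α β : Type*} [Countable α] [MeasurableSpace α]
    [MeasurableSingletonClass α] [MeasurableSpace β] {E : Set (α × β)}
    (h : ∀ a, MeasurableSet {b | (a, b) ∈ E}) : MeasurableSet E := by
  have hE : E = ⋃ a, ({a} : Set α) ×ˢ {b | (a, b) ∈ E} := by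
    ext ⟨a, b⟩
    simp
  rw [hE]
  exact MeasurableSet.iUnion fun a => (measurableSet_singleton a).prod (h a)

/-- If for each value `z ∈ E` of `F` the independent discrete variable `K` is good for `z` with
probability at least `1 - ε`, then so it is conditionally on `F ∈ E`. -/
theorem mul_measureReal_le_of_indepFun {Ω Z X : Type*} [MeasurableSpace Ω] [MeasurableSpace Z]
    [MeasurableSpace X] [MeasurableSingletonClass X] [Fintype X] {μ : Measure Ω}
    [IsProbabilityMeasure μ] {F : Ω → Z} {K : Ω → X} (hF : Measurable F) (hK : Measurable K)
    (hind : IndepFun F K μ) {p : X → ℝ} (hp : ∀ a, μ.real {ω | K ω = a} = p a)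
    {E : Set Z} (hE : MeasurableSet E) {G : X → Set Z} (hG : ∀ a, MeasurableSet (G a)) {c : ℝ}
    (hc : ∀ z ∈ E, c ≤ wt p (fun a => z ∈ G a)) :
    c * μ.real (F ⁻¹' E) ≤ μ.real {ω | F ω ∈ E ∧ F ω ∈ G (K ω)} := by
  classical
  set ν := μ.map F with hν
  have : IsProbabilityMeasure ν := Measure.isProbabilityMeasure_map hF.aemeasurable
  have hset : {ω | F ω ∈ E ∧ F ω ∈ G (K ω)} = ⋃ a, F ⁻¹' (E ∩ G a) ∩ K ⁻¹' {a} := by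
    ext ω
    simp
  have hsum : μ.real {ω | F ω ∈ E ∧ F ω ∈ G (K ω)} = ∑ a, p a * ν.real (E ∩ G a) := by
    rw [hset, measureReal_iUnion_fintype]
    · refine Finset.sum_congr rfl fun a _ => ?_
      rw [measureReal_def, hind.measure_inter_preimage_eq_mul _ _ (hE.inter (hG a))
        (measurableSet_singleton a), ENNReal.toReal_mul, ← measureReal_def, ← measureReal_def,
        hν, map_measureReal_apply hF (hE.inter (hG a)), mul_comm]
      congr 1
      exact hp a
    · intro a b hab
      refine Set.disjoint_left.2 fun ω h1 h2 => hab ?_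
      exact h1.2.symm.trans h2.2
    · exact fun a => (hF (hE.inter (hG a))).inter (hK (measurableSet_singleton a))
  have hint : ∀ a, Integrable (fun z => p a * (G a).indicator (fun _ => (1 : ℝ)) z)
      (ν.restrict E) := fun a => ((integrable_const 1).indicator (hG a)).const_mul _
  have hR : ∑ a, p a * ν.real (E ∩ G a) =
      ∫ z in E, ∑ a, p a * (G a).indicator (fun _ => (1 : ℝ)) z ∂ν := by
    rw [integral_finsetSum _ fun a _ => hint a]
    refine Finset.sum_congr rfl fun a _ => ?_
    rw [integral_const_mul, integral_indicator (hG a), setIntegral_const, smul_eq_mul, mul_one,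
      measureReal_restrict_apply' hE, Set.inter_comm]
  rw [hsum, hR, ← map_measureReal_apply hF hE, ← hν]
  calc c * ν.real E = ∫ _z in E, c ∂ν := by
        rw [setIntegral_const, smul_eq_mul, mul_comm]
    _ ≤ _ := by
        refine setIntegral_mono_on (integrable_const c) (integrable_finsetSum _ fun a _ => hint a)
          hE fun z hz => (hc z hz).trans (le_of_eq ?_)
        unfold wt
        refine Finset.sum_congr rfl fun a _ => ?_
        by_cases h : z ∈ G a <;> simp [h]

/-- The law of a family of blocks of independent discrete variables. -/
theorem measureReal_eq_prodWt {Ω α : Type*} [MeasurableSpace Ω] [MeasurableSpace α]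
    [MeasurableSingletonClass α] {μ : Measure Ω} [IsProbabilityMeasure μ] {m : ℕ}
    {K : Fin m → Ω → α} (hind : iIndepFun K μ) {p : α → ℝ}
    (hp : ∀ l a, μ.real {ω | K l ω = a} = p a) {L q : ℕ} {e : Fin L × Fin q → Fin m}
    (he : Function.Injective e) (k : Fin L → Fin q → α) :
    μ.real {ω | (fun j l => K (e (j, l)) ω) = k} = prodWt (prodWt p q) L k := by
  have h := (hind.precomp he).measure_inter_preimage_eq_mul Finset.univ
    (sets := fun r => {k r.1 r.2}) fun r _ => measurableSet_singleton _
  have hset : {ω | (fun j l => K (e (j, l)) ω) = k} =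
      ⋂ r ∈ (Finset.univ : Finset (Fin L × Fin q)),
        (fun ω => K (e r) ω) ⁻¹' {k r.1 r.2} := by
    ext ω
    simp [funext_iff]
  rw [hset, measureReal_def]
  refine (congrArg ENNReal.toReal h).trans ?_
  rw [ENNReal.toReal_prod, Fintype.prod_prod_type]
  exact Finset.prod_congr rfl fun j _ => Finset.prod_congr rfl fun l _ => hp _ _

/-! ### Success probability and choice of parameters -/

section Main

variable {n M : ℕ} {A₀ : Matrix (Fin n) (Fin n) ℂ} {I : Fin M → Finset (Fin n)} {π : Fin M → ℝ}
  {γ : ℝ}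

/-- Golfing succeeds for the sign vector and for the coordinate vectors of the support. -/
def AllGolfGood (A₀ : Matrix (Fin n) (Fin n) ℂ) (I : Fin M → Finset (Fin n)) (π : Fin M → ℝ)
    {L q : ℕ} (k : Fin L → Fin q → Fin M) : Set (Set (Fin n) × (Fin n → ℂ)) :=
  {z | GolfGood A₀ I π z.1 L k (sgn z.2) ∧
    ∀ i ∈ z.1, GolfGood A₀ I π z.1 L k (Pi.single i 1)}

theorem measurable_sgn : Measurable (sgn : (Fin n → ℂ) → Fin n → ℂ) := by
  unfold sgn
  fun_prop

theorem measurableSet_allGolfGood {L q : ℕ} (k : Fin L → Fin q → Fin M) :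
    MeasurableSet (AllGolfGood A₀ I π k) := by
  refine measurableSet_of_slices fun S => ?_
  have h : MeasurableSet ({y | GolfGood A₀ I π S L k (sgn y)} ∩
      {_y : Fin n → ℂ | ∀ i ∈ S, GolfGood A₀ I π S L k (Pi.single i 1)}) :=
    (measurable_sgn (isClosed_golfGood L k).measurableSet).inter (MeasurableSet.const _)
  exact h

theorem wt_allGolfGood_ge (hA : A₀ ∈ Matrix.unitaryGroup (Fin n) ℂ)
    (hI : ∀ i : Fin n, ∃! k : Fin M, i ∈ I k) (hπ : ∀ k, 0 < π k) (hπ1 : ∑ k, π k = 1)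
    {S : Set (Fin n)} (hγ : 0 < γ) (hΓ : Gam A₀ I π S ≤ γ) {q : ℕ} (hq : 0 < q) (L : ℕ)
    {x : Fin n → ℂ} (hx : ∀ i, i ∉ S → x i = 0) :
    1 - (n + 1) * (L * (n * (4 * Real.exp (-(q / (256 * γ)))))) ≤
      wt (prodWt (prodWt π q) L) (fun k => (S, x) ∈ AllGolfGood A₀ I π k) := by
  have hw := prodWt_nonneg (prodWt_nonneg (fun k => (hπ k).le) q) L
  rw [wt_not (sum_prodWt (sum_prodWt hπ1 q) L)]
  set δ : ℝ := L * (n * (4 * Real.exp (-(q / (256 * γ))))) with hδ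
  have hδ0 : 0 ≤ δ := by positivity
  have h1 : wt (prodWt (prodWt π q) L) (fun k => ¬ GolfGood A₀ I π S L k (sgn x)) ≤ δ :=
    wt_not_golfGood_le hA hI hπ hπ1 hγ hΓ hq L fun i hi => by simp [sgn, hx i hi]
  have h2 : ∀ i, wt (prodWt (prodWt π q) L)
      (fun k => i ∈ S ∧ ¬ GolfGood A₀ I π S L k (Pi.single i 1)) ≤ δ := by
    intro i
    by_cases hi : i ∈ S
    · simp only [hi, true_and]
      refine wt_not_golfGood_le hA hI hπ hπ1 hγ hΓ hq L fun j hj => ?_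
      rw [Pi.single_eq_of_ne]
      rintro rfl
      exact hj hi
    · rwa [wt_false _ fun _ h => hi h.1]
  have h3 := wt_exists_le hw fun (i : Fin n) k =>
    i ∈ S ∧ ¬ GolfGood A₀ I π S L k (Pi.single i 1)
  have h4 := Finset.sum_le_card_nsmul Finset.univ _ δ fun i _ => h2 i
  simp only [Finset.card_univ, Fintype.card_fin, nsmul_eq_mul] at h4
  have h5 := wt_mono hw (Q := fun k => ¬ (S, x) ∈ AllGolfGood A₀ I π k)
    (R := fun k => ¬ GolfGood A₀ I π S L k (sgn x) ∨
      ∃ i, i ∈ S ∧ ¬ GolfGood A₀ I π S L k (Pi.single i 1)) (by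
    intro k hk
    by_contra hcon
    push Not at hcon
    exact hk hcon)
  have h6 := wt_or_le hw (fun k => ¬ GolfGood A₀ I π S L k (sgn x))
    (fun k => ∃ i, i ∈ S ∧ ¬ GolfGood A₀ I π S L k (Pi.single i 1))
  linarith

/-- The numbers of rounds and of samples per round allow for the union bound. -/
theorem exists_rounds {n s m : ℕ} (hs : 2 ≤ s) (hsn : s ≤ n) {γ ε : ℝ} (hε : 0 < ε) (hε1 : ε < 1)
    (hm : 20000 * γ * Real.log s * Real.log (n / ε) ≤ m) :
    ∃ L q : ℕ, 4 * s ≤ 4 ^ L ∧ L * q ≤ m ∧ (1 ≤ γ → 0 < q ∧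
      (n + 1) * (L * (n * (4 * Real.exp (-(q / (256 * γ)))))) ≤ ε) := by
  -- `s < 2^(log₂ s + 1) ≤ 4^(log₂ s + 1)`; the additional round supplies the factor 4.
  set L := Nat.log 2 s + 2 with hLdef
  have hLpos : 0 < L := by omega
  refine ⟨L, m / L, ?_, Nat.mul_div_le m L, fun hγ => ?_⟩
  · have h1 : s < 2 ^ (Nat.log 2 s + 1) := Nat.lt_pow_succ_log_self (by norm_num) s
    have h2 : 2 ^ (Nat.log 2 s + 1) ≤ 4 ^ (Nat.log 2 s + 1) := Nat.pow_le_pow_left (by norm_num) _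
    rw [hLdef, show Nat.log 2 s + 2 = (Nat.log 2 s + 1) + 1 from rfl, pow_succ]
    omega
  have hlog2 := Real.log_two_gt_d9
  have hs2 : (2 : ℝ) ≤ s := by exact_mod_cast hs
  have hn2 : (2 : ℝ) ≤ n := by exact_mod_cast hs.trans hsn
  have hL' : (0 : ℝ) < L := by exact_mod_cast hLpos
  have hlogs : Real.log 2 ≤ Real.log s := Real.log_le_log (by norm_num) hs2
  have hLs : (L : ℝ) ≤ 5 * Real.log s := by
    have h1 : ((2 : ℕ) ^ Nat.log 2 s : ℕ) ≤ s := Nat.pow_log_le_self 2 (by omega)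
    have h2 : (Nat.log 2 s : ℝ) * Real.log 2 ≤ Real.log s := by
      rw [← Real.log_pow]
      exact Real.log_le_log (by positivity) (by exact_mod_cast h1)
    have h3 : (0 : ℝ) ≤ (Nat.log 2 s : ℝ) := by positivity
    rw [hLdef]
    push_cast
    nlinarith
  have hLn : (L : ℝ) ≤ n ^ 2 := by
    have h1 : Nat.log 2 s < s := Nat.log_lt_self 2 (by omega)
    have h2 : L ≤ n + 1 := by omega
    have h3 : (L : ℝ) ≤ n + 1 := by exact_mod_cast h2
    nlinarith
  set B := Real.log (n / ε) with hB
  have hnε : (n : ℝ) ≤ n / ε := by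
    rw [le_div_iff₀ hε]
    nlinarith
  have hBge : Real.log 2 ≤ B := Real.log_le_log (by norm_num) (hn2.trans hnε)
  have hBpos : 0 < B := by linarith
  have hγB : B ≤ γ * B := by nlinarith
  have hm2 : 4000 * (L : ℝ) * (γ * B) ≤ m := by
    have : (L : ℝ) * (γ * B) ≤ 5 * Real.log s * (γ * B) :=
      mul_le_mul_of_nonneg_right hLs (by linarith)
    linarith
  -- Half of 4000 absorbs the loss of at most one from the floor, as `γ * B ≥ log 2`.
  have hq : 2000 * (γ * B) ≤ ((m / L : ℕ) : ℝ) := by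
    have h1 : (m : ℝ) < L * ((m / L : ℕ) : ℝ) + L := by
      have := Nat.lt_mul_div_succ m hLpos
      have h2 : (m : ℝ) < L * (((m / L : ℕ) : ℝ) + 1) := by exact_mod_cast this
      linarith
    have h3 : (L : ℝ) * (4000 * (γ * B) - 1) < L * ((m / L : ℕ) : ℝ) := by linarith
    have h4 := lt_of_mul_lt_mul_left h3 hL'.le
    linarith
  refine ⟨?_, ?_⟩
  · have : (0 : ℝ) < ((m / L : ℕ) : ℝ) := by linarith
    exact_mod_cast this
  -- `2000 / 256 > 7`, and the seventh power suffices to beat the union-bound prefactor, which is at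
  -- most `n^7`.
  have hexp : Real.exp (-(((m / L : ℕ) : ℝ) / (256 * γ))) ≤ ((n / ε) ^ 7)⁻¹ := by
    have hpos : 0 < (n : ℝ) / ε := by linarith
    have h1 : ((n / ε) ^ 7)⁻¹ = Real.exp (-(7 * B)) := by
      rw [Real.exp_neg, show (7 : ℝ) * B = ((7 : ℕ) : ℝ) * B by norm_num, Real.exp_nat_mul, hB,
        Real.exp_log hpos]
    rw [h1]
    refine Real.exp_le_exp.2 (neg_le_neg ?_)
    rw [le_div_iff₀ (by linarith)]
    nlinarith
  have hpoly : ((n : ℝ) + 1) * (L * (n * 4)) ≤ n ^ 7 := by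
    have h1 : (n : ℝ) + 1 ≤ n ^ 2 := by nlinarith
    have h2 : (4 : ℝ) ≤ n ^ 2 := by nlinarith
    calc ((n : ℝ) + 1) * (L * (n * 4)) ≤ n ^ 2 * (n ^ 2 * (n * n ^ 2)) := by gcongr
      _ = n ^ 7 := by ring
  calc ((n : ℝ) + 1) * (L * (n * (4 * Real.exp (-(((m / L : ℕ) : ℝ) / (256 * γ))))))
      = ((n + 1) * (L * (n * 4))) * Real.exp (-(((m / L : ℕ) : ℝ) / (256 * γ))) := by ring
    _ ≤ n ^ 7 * ((n / ε) ^ 7)⁻¹ := by gcongr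
    _ = ε ^ 7 := by
        rw [div_pow, inv_div]
        field_simp
    _ ≤ ε := pow_le_of_le_one hε.le hε1.le (by norm_num)

end Main

end BlockCS

theorem mainTheorem9 :
    ∃ C : ℝ, 0 < C ∧
      ∀ (n M s m : ℕ), 2 ≤ s → s ≤ n →
      -- the unitary matrix, its partition into blocks of rows, and the drawing probability
      ∀ (A₀ : Matrix (Fin n) (Fin n) ℂ), A₀ ∈ Matrix.unitaryGroup (Fin n) ℂ →
      ∀ (I : Fin M → Finset (Fin n)), (∀ i : Fin n, ∃! k : Fin M, i ∈ I k) →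
      ∀ (π : Fin M → ℝ), (∀ k, 0 < π k) → ∑ k, π k = 1 →
      -- the random support, the random signal and the random block indices
      ∀ (Ω : Type*) [MeasurableSpace Ω] (μ : Measure Ω) [IsProbabilityMeasure μ]
        (S : Ω → Set (Fin n)) (x : Ω → Fin n → ℂ) (K : Fin m → Ω → Fin M),
        Measurable S → Measurable x → (∀ l, Measurable (K l)) →
        (∀ᵐ ω ∂μ, (S ω).ncard ≤ s) →
        (∀ᵐ ω ∂μ, ∀ i, i ∉ S ω → x ω i = 0) →
        iIndepFun K μ →
        (∀ l k, μ.real {ω | K l ω = k} = π k) →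
        IndepFun (fun ω => (S ω, x ω)) (fun ω l => K l ω) μ →
      ∀ (γ ε ε' : ℝ), 0 < γ → 0 < ε → ε < 1 →
        1 - ε' ≤ μ.real {ω | BlockCS.Gam A₀ I π (S ω) ≤ γ} →
        C * γ * Real.log s * Real.log (n / ε) ≤ m →
        (1 - ε) * (1 - ε') ≤
          μ.real {ω | BlockCS.IsUniqueL1Min
            (BlockCS.sensing A₀ I π fun l => K l ω)
            (BlockCS.sensing A₀ I π (fun l => K l ω) *ᵥ x ω) (x ω)} := by
  refine ⟨20000, by norm_num, ?_⟩
  intro n M s m hs hsn A₀ hA I hI π hπ hπ1 Ω _ μ _ S x K hS hx hK hcard hsupp hKind hlaw hind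
    γ ε ε' hγ hε hε1 hΓ hm
  obtain ⟨L, q, hL, hLq, hround⟩ := BlockCS.exists_rounds hs hsn hε hε1 hm
  -- The rounds use only the first `L * q` samples. Any others just add constraints on kernel
  -- vectors.
  set e : Fin L × Fin q → Fin m := fun r => Fin.castLE hLq (finProdFinEquiv r) with he
  have heinj : Function.Injective e :=
    (Fin.castLE_injective hLq).comp finProdFinEquiv.injective
  set E : Set (Set (Fin n) × (Fin n → ℂ)) :=
    {z | BlockCS.Gam A₀ I π z.1 ≤ γ ∧ z.1.ncard ≤ s ∧ ∀ i, i ∉ z.1 → z.2 i = 0} with hE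
  have hEm : MeasurableSet E := by
    refine BlockCS.measurableSet_of_slices fun T => ?_
    have h1 : MeasurableSet {y : Fin n → ℂ | ∀ i, i ∉ T → y i = 0} := by
      simp only [Set.ofPred_forall]
      exact MeasurableSet.iInter fun i => MeasurableSet.iInter fun _ =>
        measurableSet_eq_fun (measurable_pi_apply i) measurable_const
    have h2 : MeasurableSet ({_y : Fin n → ℂ | BlockCS.Gam A₀ I π T ≤ γ} ∩
        ({_y | T.ncard ≤ s} ∩ {y | ∀ i, i ∉ T → y i = 0})) :=
      (MeasurableSet.const _).inter ((MeasurableSet.const _).inter h1)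
    exact h2
  have hKe : Measurable fun k : Fin m → Fin M => fun (j : Fin L) (l : Fin q) => k (e (j, l)) := by
    fun_prop
  have hgood : ∀ z ∈ E, 1 - ε ≤ BlockCS.wt (BlockCS.prodWt (BlockCS.prodWt π q) L)
      (fun k => z ∈ BlockCS.AllGolfGood A₀ I π k) := by
    rintro ⟨T, y⟩ ⟨h1, -, h3⟩
    -- On an empty support `γ ≥ 1` may fail and `q` may be `0`; but then `y = 0` and golfing
    -- succeeds trivially.
    rcases T.eq_empty_or_nonempty with rfl | hT
    · have hy : y = 0 := funext fun i => h3 i (Set.notMem_empty i)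
      have h0 : BlockCS.sgn y = 0 := by
        ext i
        simp [BlockCS.sgn, hy]
      have hall : ∀ k : Fin L → Fin q → Fin M, (∅, y) ∈ BlockCS.AllGolfGood A₀ I π k := fun k => by
        refine ⟨?_, fun i hi => absurd hi (Set.notMem_empty i)⟩
        simp only [h0]
        exact BlockCS.golfGood_zero L k
      rw [BlockCS.wt_not (BlockCS.sum_prodWt (BlockCS.sum_prodWt hπ1 q) L),
        BlockCS.wt_false _ fun k hk => hk (hall k)]
      linarith
    · obtain ⟨hq, hfail⟩ := hround (BlockCS.one_le_of_Gam_le hA hI hπ hπ1 h1 hT)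
      have := BlockCS.wt_allGolfGood_ge hA hI hπ hπ1 hγ h1 hq L h3
      linarith
  have hmain := BlockCS.mul_measureReal_le_of_indepFun (μ := μ) (hS.prodMk hx)
    (hKe.comp (measurable_pi_lambda (fun ω l => K l ω) hK)) (hind.comp measurable_id hKe)
    (fun k => BlockCS.measureReal_eq_prodWt hKind hlaw heinj k) hEm
    (fun k => BlockCS.measurableSet_allGolfGood k) hgood
  have hEae : μ.real {ω | BlockCS.Gam A₀ I π (S ω) ≤ γ} =
      μ.real ((fun ω => (S ω, x ω)) ⁻¹' E) := by
    refine measureReal_congr ?_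
    filter_upwards [hcard, hsupp] with ω h1 h2
    exact propext ⟨fun h => ⟨h, h1, h2⟩, fun h => h.1⟩
  calc (1 - ε) * (1 - ε') ≤ (1 - ε) * μ.real ((fun ω => (S ω, x ω)) ⁻¹' E) := by
        rw [← hEae]
        exact mul_le_mul_of_nonneg_left hΓ (by linarith)
    _ ≤ _ := hmain
    _ ≤ _ := by
        refine measureReal_mono ?_
        rintro ω ⟨⟨-, h2, h3⟩, h4, h5⟩
        exact BlockCS.isUniqueL1Min_of_golfGood hπ (fun j l => e (j, l)) h3 h2 hL h4 h5
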